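/- Let $(X,Y)$ be a pair of real random variables with marginal laws $F$ and $G$ and supports $D_X\subset\mathbb R$ and $D_Y\subset[0,\infty)$, following a bivariate Sarmanov distribution, i.e. $$P(X\in dx,\,Y\in dy)=(1+\theta\phi_1(x)\phi_2(y))\,F(dx)\,G(dy),$$ where $\theta\in\mathbb R$ and $\phi_1,\phi_2$ are real functions with $E[\phi_1(X)]=E[\phi_2(Y)]=0$ and $1+\theta\phi_1(x)\phi_2(y)\ge 0$ for all $x\in D_X$, $y\in D_Y$. Write $\overline F(x)=P[X>x]$. Let $\alpha>0$ and assume that $X\ge 0$ almost surely, that $\overline F(xy)/\overline F(x)\to y^{-\alpha}$ as $x\to\infty$ for every $y>0$, that $E[Y^\alpha]<\infty$, that $P[Y>x]=o(P[X>x])$ as $x\to\infty$, and that $\lim_{x\to\infty}\phi_1(x)=d_1\in\mathbb R$ exists. Put $L(x)=x^\alpha\overline F(x)$. A random variable $U$ is called long tailed if $P[U>x+y]/P[U>x]\to1$ as $x\to\infty$ for every $y\in\mathbb R$. A nonnegative function $f$ on $[0,\infty)$ is in $\mathcal S_d$ if $\lim_{x\to\infty}\int_0^x\frac{f(x-y)}{f(x)}f(y)\,dy=2\int_0^\infty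 f(u)\,du<\infty$ (with $f(x)>0$ for all large $x$), and $U\in\mathcal S^*$ means that $x\mapsto P[U>x]$ is in $\mathcal S_d$. We say that $L$ is of type (iii) if $L(x)=c(x)P[U>\log x]$, and of type (iv) if $L(x)=c(x)P[U>\log x]/P[V>\log x]$, for all $x>0$, where $U,V$ are long tailed and $c(x)\to c\in(0,\infty)$ as $x\to\infty$. Assume that at least one of the following conditions holds. (DZ2) $L$ is of type (iii) or (iv), and $x\mapsto L(e^x)$ is in $\mathcal S_d$. (DZ3) $L$ is of type (iii) or (iv) with some $U\in\mathcal S^*$ such that $P[Y>x]=o(x^{-\alpha}P[U>\log x])$ as $x\to\infty$. (DZ4) $E[X^\alpha]=\infty$, $P[Y>x]=o(\overline F(x)/m(x))$ as $x\to\infty$, where $m(x)=\int_0^x v^\alpha F(dv)$, and $\limsup_{x\to\infty}\sup_{\sqrt x\le y\le x}L(y)/L(x)<\infty$. Then $$P[XY>x]\sim\bigl(E[Y^\alpha]+\theta d_1E[\phi_2(Y)Y^\alpha]\bigr)\overline F(x)\qquad(x\to\infty),$$ in the sense that $P[XY>x]/\overline F(x)$ converges to $E[Y^\alpha]+\theta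 d_1E[\phi_2(Y)Y^\alpha]$. Here $E[\phi_2(Y)Y^\alpha]$ exists and is finite whenever $\theta d_1\neq0$; if $\theta d_1=0$ the second summand is read as $0$. -/

import Mathlib

open MeasureTheory Filter Topology Asymptotics Set

namespace SarmanovProduct

noncomputable section

/-- The right tail `x ↦ P[Z > x]` of a random variable `Z` with law `μ`. -/
def tail (μ : Measure ℝ) (x : ℝ) : ℝ := μ.real (Ioi x)

/-- The pair `(X, Y)` follows a bivariate Sarmanov distribution with kernels `φ₁`, `φ₂` and
parameter `θ`: its joint law is `(1 + θ φ₁(x) φ₂(y)) F(dx) G(dy)`, where `F` and `G` are the laws of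
`X` and of `Y ≥ 0`, the kernels have mean zero, and the density is nonnegative on the product of the
supports of `X` and `Y`. -/
structure IsBivariateSarmanov {Ω : Type*} [MeasurableSpace Ω] (P : Measure Ω) (X Y : Ω → ℝ)
    (φ₁ φ₂ : ℝ → ℝ) (θ : ℝ) : Prop where
  measurable_left : Measurable X
  measurable_right : Measurable Y
  support_right : (P.map Y).support ⊆ Ici 0
  integrable_left : Integrable φ₁ (P.map X)
  integral_left : ∫ x, φ₁ x ∂(P.map X) = 0
  integrable_right : Integrable φ₂ (P.map Y)
  integral_right : ∫ y, φ₂ y ∂(P.map Y) = 0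
  density_nonneg : ∀ x ∈ (P.map X).support, ∀ y ∈ (P.map Y).support, 0 ≤ 1 + θ * φ₁ x * φ₂ y
  joint_law : P.map (fun ω => (X ω, Y ω)) = ((P.map X).prod (P.map Y)).withDensity
    fun p => ENNReal.ofReal (1 + θ * φ₁ p.1 * φ₂ p.2)

/-- The law `μ` has a regularly varying right tail with index `-α`. (The limit is nonzero, so the
tail is positive everywhere and the ratio is a genuine one.) -/
def IsRegularlyVarying (μ : Measure ℝ) (α : ℝ) : Prop :=
  0 < α ∧ ∀ y : ℝ, 0 < y →
    Tendsto (fun x => tail μ (x * y) / tail μ x) atTop (𝓝 (y ^ (-α)))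

/-- The law `μ` is long tailed. -/
def IsLongTailed (μ : Measure ℝ) : Prop :=
  ∀ y : ℝ, Tendsto (fun x => tail μ (x + y) / tail μ x) atTop (𝓝 1)

/-- The class `𝒮_d` of subexponential densities. -/
structure IsSubexponentialDensity (f : ℝ → ℝ) : Prop where
  nonneg : ∀ x, 0 ≤ x → 0 ≤ f x
  eventually_pos : ∀ᶠ x in atTop, 0 < f x
  integrable : IntegrableOn f (Ioi 0)
  eventually_integrable : ∀ᶠ x in atTop,
    IntervalIntegrable (fun y => f (x - y) / f x * f y) volume 0 x
  tendsto : Tendsto (fun x => ∫ y in (0 : ℝ)..x, f (x - y) / f x * f y) atTop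
    (𝓝 (2 * ∫ u in Ioi (0 : ℝ), f u))

/-- The class `𝒮*` of laws whose tail is a subexponential density. -/
def IsStronglySubexponential (μ : Measure ℝ) : Prop := IsSubexponentialDensity (tail μ)

/-- The function `L` in `P[X > x] = x ^ (-α) * L x`, for `X` with law `F`. -/
def slowPart (F : Measure ℝ) (α x : ℝ) : ℝ := x ^ α * tail F x

/-- `L(x) = c(x) P(U > log x)` with `U` long tailed and `c(x) → c ∈ (0, ∞)`. -/
def IsTypeIII (L : ℝ → ℝ) (U : Measure ℝ) : Prop :=
  IsProbabilityMeasure U ∧ IsLongTailed U ∧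
    ∃ (c : ℝ → ℝ) (c₀ : ℝ), 0 < c₀ ∧ Tendsto c atTop (𝓝 c₀) ∧
      ∀ x, 0 < x → L x = c x * tail U (Real.log x)

/-- `L(x) = c(x) P(U > log x) / P(V > log x)` with `U`, `V` long tailed and
`c(x) → c ∈ (0, ∞)`. -/
def IsTypeIV (L : ℝ → ℝ) (U V : Measure ℝ) : Prop :=
  IsProbabilityMeasure U ∧ IsProbabilityMeasure V ∧ IsLongTailed U ∧ IsLongTailed V ∧
    ∃ (c : ℝ → ℝ) (c₀ : ℝ), 0 < c₀ ∧ Tendsto c atTop (𝓝 c₀) ∧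
      ∀ x, 0 < x → L x = c x * tail U (Real.log x) / tail V (Real.log x)

/-- `L` is of type (iii) or (iv), where the long tailed variable in the numerator has law `U`. -/
def IsTypeIIIOrIV (L : ℝ → ℝ) (U : Measure ℝ) : Prop :=
  IsTypeIII L U ∨ ∃ V : Measure ℝ, IsTypeIV L U V

/-- Condition (DZ2), for `X` with law `F`. -/
def DZ2 (F : Measure ℝ) (α : ℝ) : Prop :=
  (∃ U : Measure ℝ, IsTypeIIIOrIV (slowPart F α) U) ∧
    IsSubexponentialDensity (fun x => slowPart F α (Real.exp x))

/-- Condition (DZ3), for `X` with law `F` and `Y` with law `G`. -/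
def DZ3 (F G : Measure ℝ) (α : ℝ) : Prop :=
  ∃ U : Measure ℝ, IsTypeIIIOrIV (slowPart F α) U ∧ IsStronglySubexponential U ∧
    tail G =o[atTop] fun x => x ^ (-α) * tail U (Real.log x)

/-- The truncated moment `m(x) = ∫₀ˣ v ^ α F(dv)`. -/
def truncatedMoment (F : Measure ℝ) (α x : ℝ) : ℝ := ∫ v in Icc 0 x, v ^ α ∂F

/-- Condition (DZ4), for `X ≥ 0` with law `F` and `Y` with law `G`. The last clause says
`limsup_{x → ∞} sup_{√x ≤ y ≤ x} L(y) / L(x) < ∞`. -/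
def DZ4 (F G : Measure ℝ) (α : ℝ) : Prop :=
  ∫⁻ v, ENNReal.ofReal (v ^ α) ∂F = ⊤ ∧
    (tail G =o[atTop] fun x => tail F x / truncatedMoment F α x) ∧
    ∃ C : ℝ, ∀ᶠ x in atTop, ∀ y ∈ Icc (Real.sqrt x) x, slowPart F α y / slowPart F α x ≤ C

end

end SarmanovProduct

open SarmanovProduct

open SarmanovProduct

namespace SarmanovProduct

/-! The argument is Breiman's, by slicing along the second factor. Put k(u,v) = 1 + θφ₁(u)φ₂(v) and
κ(v) = 1 + θd₁φ₂(v), the limit of k(u,v) as u → ∞. Then P[XY > x] is the integral of k over {uv > x}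
against F ⊗ G. For fixed v > 0 the slice is u > x/v: there k averages to κ(v), while regular
variation gives F̄(x/v)/F̄(x) → v^α. Hence the slice divided by F̄(x) tends to κ(v)v^α, whose
G-integral is the claimed constant.

The limit must be exchanged with the integral over v. For v ≤ A monotonicity of F̄ gives a constant
dominating function. For v > A one needs `HasNegligibleLargeFactor`. This involves only the
marginals, because k is bounded almost everywhere (`IsBivariateSarmanov.exists_abs_le`): a mean-zero
kernel that is not null takes both signs, so nonnegativity of the density bounds the other kernel on
both sides.

The alternatives in the hypothesis serve only to establish this negligibility. Under (DZ2) and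
(DZ3), on the scale x = e^t, the contribution of large v is bounded by a small multiple of F̄(x)
times the convolution ∫ w(t-y)w(y)/w(t) dy for a subexponential density w, which stays bounded
(`hasNegligibleLargeFactor_of_subexponential`). Under (DZ4) the plane is cut at √x in each variable,
and the truncated moment absorbs the range where v is large and u moderate.
`tendsto_setIntegral_mul_div_tail` performs the exchange of limits. -/

/-! ### Tails and regular variation -/

lemma tail_nonneg (μ : Measure ℝ) (x : ℝ) : 0 ≤ tail μ x := measureReal_nonneg

lemma tail_antitone (μ : Measure ℝ) [IsFiniteMeasure μ] : Antitone (tail μ) :=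
  fun _ _ h => measureReal_mono (Ioi_subset_Ioi h)

lemma ofReal_tail (μ : Measure ℝ) [IsFiniteMeasure μ] (x : ℝ) :
    ENNReal.ofReal (tail μ x) = μ (Ioi x) := by
  simp [tail]

/-- Division by zero gives `0`, so a ratio of tails with nonzero limit has an eventually nonzero
denominator; monotonicity carries positivity back to every point. -/
lemma tail_pos_of_eventually_ne {μ : Measure ℝ} [IsFiniteMeasure μ]
    (h : ∀ᶠ x in atTop, tail μ x ≠ 0) (x : ℝ) : 0 < tail μ x := by
  obtain ⟨z, hz, hxz⟩ := (h.and (eventually_ge_atTop x)).exists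
  exact ((tail_nonneg μ z).lt_of_ne' hz).trans_le (tail_antitone μ hxz)

lemma IsLongTailed.tail_pos {μ : Measure ℝ} [IsFiniteMeasure μ] (h : IsLongTailed μ) (x : ℝ) :
    0 < tail μ x := by
  refine tail_pos_of_eventually_ne ?_ x
  filter_upwards [(h 0).eventually_ne one_ne_zero] with z hz h0
  simp [h0] at hz

lemma IsRegularlyVarying.tail_pos {μ : Measure ℝ} [IsFiniteMeasure μ] {α : ℝ}
    (h : IsRegularlyVarying μ α) (x : ℝ) : 0 < tail μ x := by
  refine tail_pos_of_eventually_ne ?_ x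
  have h1 := h.2 1 one_pos
  rw [Real.one_rpow] at h1
  filter_upwards [h1.eventually_ne one_ne_zero] with z hz h0
  simp [h0] at hz

lemma IsRegularlyVarying.tendsto_div {μ : Measure ℝ} {α : ℝ}
    (h : IsRegularlyVarying μ α) {v : ℝ} (hv : 0 < v) :
    Tendsto (fun x => tail μ (x / v) / tail μ x) atTop (𝓝 (v ^ α)) := by
  have := h.2 v⁻¹ (inv_pos.2 hv)
  rwa [Real.inv_rpow hv.le, Real.rpow_neg hv.le, inv_inv] at this

/-- Shrinking the argument by a fixed factor enlarges the tail at most by a constant factor. -/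
lemma IsRegularlyVarying.eventually_tail_div_le {μ : Measure ℝ} [IsFiniteMeasure μ] {α : ℝ}
    (h : IsRegularlyVarying μ α) {v : ℝ} (hv : 0 < v) :
    ∀ᶠ x in atTop, tail μ (x / v) ≤ (v ^ α + 1) * tail μ x := by
  filter_upwards [(h.tendsto_div hv).eventually_lt_const (lt_add_one _)] with x hx
  exact ((div_lt_iff₀ (h.tail_pos x)).1 hx).le

lemma slowPart_exp (μ : Measure ℝ) (α t : ℝ) :
    slowPart μ α (Real.exp t) = Real.exp (α * t) * tail μ (Real.exp t) := by
  rw [slowPart, ← Real.exp_mul, mul_comm t]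

lemma slowPart_pos {μ : Measure ℝ} [IsFiniteMeasure μ] {α : ℝ} (h : IsRegularlyVarying μ α)
    {x : ℝ} (hx : 0 < x) : 0 < slowPart μ α x :=
  mul_pos (Real.rpow_pos_of_pos hx _) (h.tail_pos x)

lemma tail_eq_rpow_mul_slowPart (μ : Measure ℝ) (α : ℝ) {x : ℝ} (hx : 0 < x) :
    tail μ x = x ^ (-α) * slowPart μ α x := by
  rw [slowPart, ← mul_assoc, ← Real.rpow_add hx]; simp

/-! ### Negligibility of large second factors -/

/-- The part of the product tail with a large second factor is small. -/
def HasNegligibleLargeFactor (F G : Measure ℝ) : Prop :=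
  ∀ ε : ℝ, 0 < ε → ∀ᶠ A in atTop, ∀ᶠ x in atTop,
    ∫⁻ v in Ioi A, F (Ioi (x / v)) ∂G ≤ ENNReal.ofReal (ε * tail F x)

lemma measurable_tail_div (F : Measure ℝ) [IsFiniteMeasure F] (x : ℝ) :
    Measurable fun v => F (Ioi (x / v)) := by
  have : Antitone fun z => F (Ioi z) := fun _ _ h => measure_mono (Ioi_subset_Ioi h)
  exact this.measurable.comp (by fun_prop)

/-- Only the range `A < v ≤ x / B` matters for the part with a large second factor. -/
lemma hasNegligibleLargeFactor_of_Ioc {F G : Measure ℝ} [IsProbabilityMeasure F]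
    [IsProbabilityMeasure G] {α : ℝ} (hF : IsRegularlyVarying F α)
    (hGF : tail G =o[atTop] tail F) {B : ℝ} (hB : 0 < B)
    (h : ∀ ε : ℝ, 0 < ε → ∀ᶠ A in atTop, ∀ᶠ x in atTop,
      ∫⁻ v in Ioc A (x / B), F (Ioi (x / v)) ∂G ≤ ENNReal.ofReal (ε * tail F x)) :
    HasNegligibleLargeFactor F G := by
  intro ε hε
  have hcB : 0 < B ^ α + 1 := by positivity
  filter_upwards [h (ε / 2) (half_pos hε)] with A hA
  have hdiv : Tendsto (fun x : ℝ => x / B) atTop atTop := tendsto_id.atTop_div_const hB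
  filter_upwards [hA, hF.eventually_tail_div_le hB,
    hdiv.eventually (hGF.def (c := ε / 2 / (B ^ α + 1)) (by positivity))] with x h1 h2 h3
  rw [Real.norm_of_nonneg (tail_nonneg _ _), Real.norm_of_nonneg (tail_nonneg _ _)] at h3
  have h4 : tail G (x / B) ≤ ε / 2 * tail F x := by
    calc _ ≤ _ := h3
      _ ≤ ε / 2 / (B ^ α + 1) * ((B ^ α + 1) * tail F x) := by gcongr
      _ = _ := by field_simp
  have hsub : Ioi A ⊆ Ioc A (x / B) ∪ Ioi (x / B) := fun v hv => by
    rcases le_or_gt v (x / B) with h | h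
    · exact Or.inl ⟨hv, h⟩
    · exact Or.inr h
  calc _ ≤ ∫⁻ v in Ioc A (x / B) ∪ Ioi (x / B), F (Ioi (x / v)) ∂G := lintegral_mono_set hsub
    _ ≤ _ := lintegral_union_le _ _ _
    _ ≤ ENNReal.ofReal (ε / 2 * tail F x) + ENNReal.ofReal (ε / 2 * tail F x) := by
      refine add_le_add h1 ?_
      -- Beyond x / B the tail of `F` is bounded by 1, and what remains is the tail of `G`,
      -- negligible at x / B and hence, by regular variation, relative to the tail of `F` at x.
      calc _ ≤ ∫⁻ v in Ioi (x / B), 1 ∂G := lintegral_mono fun v => prob_le_one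
        _ = ENNReal.ofReal (tail G (x / B)) := by rw [ofReal_tail]; simp
        _ ≤ _ := ENNReal.ofReal_le_ofReal h4
    _ = _ := by
      have := tail_nonneg F x
      rw [← ENNReal.ofReal_add (by positivity) (by positivity)]; congr 1; ring

/-! ### Convolution on the logarithmic scale: (DZ2) and (DZ3) -/

/-- The tail of `F` at `x / v` is controlled by its averages over a unit interval on the
logarithmic scale. -/
lemma measure_Ioi_div_le_lintegral {F : Measure ℝ} [IsFiniteMeasure F] {C t v : ℝ} (hv : 0 < v)
    (hC : 0 ≤ C)
    (h : tail F (Real.exp (t - Real.log v)) ≤ C * tail F (Real.exp (t - Real.log v + 1))) :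
    F (Ioi (Real.exp t / v)) ≤
      ∫⁻ y in Ico (Real.log v - 1) (Real.log v), ENNReal.ofReal (C * tail F (Real.exp (t - y))) := by
  have h1 : Real.exp t / v = Real.exp (t - Real.log v) := by rw [Real.exp_sub, Real.exp_log hv]
  calc F (Ioi (Real.exp t / v))
      = ∫⁻ y in Ico (Real.log v - 1) (Real.log v), F (Ioi (Real.exp t / v)) := by simp
    _ ≤ _ := by
      refine setLIntegral_mono' measurableSet_Ico fun y hy => ?_
      rw [h1, ← ofReal_tail]
      refine ENNReal.ofReal_le_ofReal (h.trans ?_)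
      gcongr
      exact tail_antitone F (Real.exp_le_exp.2 (by linarith [hy.1]))

/-- Comparison of the product tail over `A < v ≤ e ^ (t - b)` with a convolution integral on the
logarithmic scale. -/
lemma lintegral_Ioc_le_lintegral_exp {F G : Measure ℝ} [IsProbabilityMeasure F]
    [IsProbabilityMeasure G] {A b t y₀ C : ℝ} (hC : 0 ≤ C)
    (hA : Real.exp (y₀ + 1) ≤ A)
    (h : ∀ r, b ≤ r → tail F (Real.exp r) ≤ C * tail F (Real.exp (r + 1))) :
    ∫⁻ v in Ioc A (Real.exp t / Real.exp b), F (Ioi (Real.exp t / v)) ∂G ≤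
      ∫⁻ y in Ioc y₀ (t - b),
        ENNReal.ofReal (C * tail F (Real.exp (t - y)) * tail G (Real.exp y)) := by
  set S := Ioc A (Real.exp t / Real.exp b) with hS
  -- Each v is smeared over the unit window [log v - 1, log v) in y. Swapping the integrals over
  -- this strip replaces the measure `G` by its tail against Lebesgue measure, so no density of `G`
  -- is needed.
  set E : Set (ℝ × ℝ) := {p | p.1 ∈ S ∧ Real.log p.1 - 1 ≤ p.2 ∧ p.2 < Real.log p.1} with hE
  have hEm : MeasurableSet E := by
    refine MeasurableSet.inter (measurable_fst measurableSet_Ioc) (MeasurableSet.inter ?_ ?_)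
    · exact measurableSet_le ((Real.measurable_log.comp measurable_fst).sub_const 1) measurable_snd
    · exact measurableSet_lt measurable_snd (Real.measurable_log.comp measurable_fst)
  have hApos : 0 < A := (Real.exp_pos _).trans_le hA
  have htm : Measurable (fun y => ENNReal.ofReal (C * tail F (Real.exp (t - y)))) := by
    have := (tail_antitone F).measurable
    fun_prop
  have hfm : Measurable (E.indicator fun p => ENNReal.ofReal (C * tail F (Real.exp (t - p.2)))) :=
    (htm.comp measurable_snd).indicator hEm
  have hrange : ∀ v ∈ S, ∀ y, Real.log v - 1 ≤ y → y < Real.log v →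
      y ∈ Ioc y₀ (t - b) := by
    intro v hv y h1 h2
    have hv0 : 0 < v := hApos.trans hv.1
    have h3 : y₀ + 1 < Real.log v := (Real.lt_log_iff_exp_lt hv0).2 (hA.trans_lt hv.1)
    have h4 : Real.log v ≤ t - b := by
      rw [Real.log_le_iff_le_exp hv0, Real.exp_sub]; exact hv.2
    exact ⟨by linarith, by linarith⟩
  calc ∫⁻ v in S, F (Ioi (Real.exp t / v)) ∂G
      ≤ ∫⁻ v, (∫⁻ y, E.indicator (fun p => ENNReal.ofReal (C * tail F (Real.exp (t - p.2))))
          (v, y)) ∂G := by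
        rw [← lintegral_indicator measurableSet_Ioc]
        refine lintegral_mono fun v => ?_
        by_cases hv : v ∈ S
        · rw [indicator_of_mem hv]
          have hv0 : 0 < v := hApos.trans hv.1
          have h4 : Real.log v ≤ t - b := by
            rw [Real.log_le_iff_le_exp hv0, Real.exp_sub]; exact hv.2
          refine (measure_Ioi_div_le_lintegral hv0 hC (h _ (by linarith))).trans ?_
          rw [← lintegral_indicator measurableSet_Ico]
          refine lintegral_mono fun y => ?_
          by_cases hy : y ∈ Ico (Real.log v - 1) (Real.log v)
          · rw [indicator_of_mem hy, indicator_of_mem (show (v, y) ∈ E from ⟨hv, hy.1, hy.2⟩)]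
          · rw [indicator_of_notMem hy]; exact zero_le
        · rw [indicator_of_notMem hv]; exact zero_le
    _ = ∫⁻ y, ∫⁻ v, E.indicator (fun p => ENNReal.ofReal (C * tail F (Real.exp (t - p.2))))
          (v, y) ∂G := by
        refine lintegral_lintegral_swap (f := fun v y => E.indicator
          (fun p => ENNReal.ofReal (C * tail F (Real.exp (t - p.2)))) (v, y)) ?_
        exact hfm.aemeasurable
    _ ≤ _ := by
        rw [← lintegral_indicator measurableSet_Ioc]
        refine lintegral_mono fun y => ?_
        by_cases hy : y ∈ Ioc y₀ (t - b)
        · rw [indicator_of_mem hy]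
          -- For fixed y the strip lies in v > e ^ y, which produces the factor `tail G (Real.exp
          -- y)`.
          calc _ ≤ ∫⁻ v in Ioi (Real.exp y), ENNReal.ofReal (C * tail F (Real.exp (t - y))) ∂G := by
                rw [← lintegral_indicator measurableSet_Ioi]
                refine lintegral_mono fun v => ?_
                by_cases hv : (v, y) ∈ E
                · have hv0 : 0 < v := hApos.trans hv.1.1
                  rw [indicator_of_mem hv, indicator_of_mem]
                  exact (Real.lt_log_iff_exp_lt hv0).1 hv.2.2
                · rw [indicator_of_notMem hv]; exact zero_le
            _ = _ := by
                have := tail_nonneg F (Real.exp (t - y))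
                rw [setLIntegral_const, ← ofReal_tail, ← ENNReal.ofReal_mul (by positivity)]
        · rw [indicator_of_notMem hy]
          refine le_of_eq ?_
          rw [lintegral_eq_zero_iff' (by fun_prop)]
          refine Eventually.of_forall fun v => indicator_of_notMem ?_ _
          exact fun hv => hy (hrange v hv.1 y hv.2.1 hv.2.2)

/-- A product tail criterion: the slowly varying part of `F` is comparable to a subexponential
density `w` on the logarithmic scale, and the tail of `G` is negligible with respect to it. -/
lemma hasNegligibleLargeFactor_of_subexponential {F G : Measure ℝ} [IsProbabilityMeasure F]
    [IsProbabilityMeasure G] {α : ℝ} (hF : IsRegularlyVarying F α)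
    (hGF : tail G =o[atTop] tail F) {w : ℝ → ℝ} (hw : IsSubexponentialDensity w)
    {C b : ℝ} (hC : 0 ≤ C)
    (hcomp : ∀ r t, b ≤ r → r ≤ t →
      slowPart F α (Real.exp r) * w t ≤ C * slowPart F α (Real.exp t) * w r)
    (hG : ∀ ε : ℝ, 0 < ε → ∀ᶠ y in atTop, tail G (Real.exp y) ≤ ε * (Real.exp (-α * y) * w y)) :
    HasNegligibleLargeFactor F G := by
  obtain ⟨C₁, hC₁, hdouble⟩ : ∃ C₁ : ℝ, 0 ≤ C₁ ∧
      ∀ᶠ r in atTop, tail F (Real.exp r) ≤ C₁ * tail F (Real.exp (r + 1)) := by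
    refine ⟨Real.exp 1 ^ α + 1, by positivity, ?_⟩
    have hexp : Tendsto (fun r : ℝ => Real.exp (r + 1)) atTop atTop :=
      Real.tendsto_exp_atTop.comp (tendsto_atTop_add_const_right _ _ tendsto_id)
    filter_upwards [hexp.eventually (hF.eventually_tail_div_le (Real.exp_pos 1))] with r hr
    rwa [← Real.exp_sub, add_sub_cancel_right] at hr
  obtain ⟨b', hb'⟩ := eventually_atTop.1 hdouble
  -- Beyond β both the comparison `hcomp` and the doubling bound hold.
  set β := max b (max b' 0) with hβ
  have hβb : b ≤ β := le_max_left _ _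
  have hβb' : b' ≤ β := (le_max_left _ _).trans (le_max_right _ _)
  have hβ0 : 0 ≤ β := (le_max_right _ _).trans (le_max_right _ _)
  -- One more than the limit of the convolution integral, hence an eventual upper bound for it.
  set M := 2 * (∫ u in Ioi (0 : ℝ), w u) + 1 with hM
  have hM0 : 0 < M := by
    have : 0 ≤ ∫ u in Ioi (0 : ℝ), w u :=
      setIntegral_nonneg measurableSet_Ioi fun u hu => hw.nonneg u (le_of_lt hu)
    positivity
  refine hasNegligibleLargeFactor_of_Ioc hF hGF (Real.exp_pos β) fun ε hε => ?_
  -- Chosen so that (C₁ C + 1) ε' M = ε; the added 1 keeps the denominator nonzero.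
  set ε' := ε / ((C₁ * C + 1) * M) with hε'
  have hε'0 : 0 < ε' := by positivity
  obtain ⟨y₁, hy₁⟩ := eventually_atTop.1 (hG ε' hε'0)
  set y₀ := max y₁ 0 with hy₀
  filter_upwards [eventually_ge_atTop (Real.exp (y₀ + 1))] with A hA
  filter_upwards [Real.tendsto_log_atTop.eventually (hw.eventually_pos.and
    (hw.eventually_integrable.and ((hw.tendsto.eventually_lt_const (lt_add_one _)).and
      (eventually_ge_atTop 0)))), eventually_gt_atTop 0] with x hx hx0
  obtain ⟨t, rfl⟩ : ∃ t, x = Real.exp t := ⟨Real.log x, (Real.exp_log hx0).symm⟩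
  rw [Real.log_exp] at hx
  obtain ⟨hwt, hint, hlt, ht0⟩ := hx
  refine (lintegral_Ioc_le_lintegral_exp hC₁ hA fun r hr => hb' r (hβb'.trans hr)).trans ?_
  have hFt := hF.tail_pos (Real.exp t)
  calc _ ≤ ∫⁻ y in Ioc y₀ (t - β), ENNReal.ofReal
          (C₁ * C * ε' * tail F (Real.exp t) * (w (t - y) / w t * w y)) := by
        refine setLIntegral_mono' measurableSet_Ioc fun y hy => ENNReal.ofReal_le_ofReal ?_
        have hy0 : 0 ≤ y := (le_max_right _ _).trans hy.1.le
        have h1 := hcomp (t - y) t (by linarith [hy.2]) (by linarith)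
        have h2 := hy₁ y ((le_max_left _ _).trans hy.1.le)
        have hwy := hw.nonneg y hy0
        have hwty := hw.nonneg (t - y) (by linarith [hy.2])
        rw [slowPart_exp, slowPart_exp] at h1
        have h3 : tail F (Real.exp (t - y)) ≤
            C * Real.exp (α * y) * tail F (Real.exp t) * (w (t - y) / w t) := by
          rw [mul_div_assoc', le_div_iff₀ hwt]
          have e1 : Real.exp (α * y) * Real.exp (α * (t - y)) = Real.exp (α * t) := by
            rw [← Real.exp_add]; congr 1; ring
          have h4 : 0 < Real.exp (α * (t - y)) := Real.exp_pos _
          refine le_of_mul_le_mul_left ?_ h4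
          rw [← e1] at h1
          nlinarith [h1]
        -- The factor e ^ (αy) lost by the tail of `F` cancels the e ^ (-αy) gained from the tail of
        -- `G`, leaving the convolution integrand.
        have e2 : Real.exp (α * y) * Real.exp (-α * y) = 1 := by
          rw [← Real.exp_add]; simp
        calc _ ≤ C₁ * (C * Real.exp (α * y) * tail F (Real.exp t) * (w (t - y) / w t)) *
              (ε' * (Real.exp (-α * y) * w y)) := by
              have := tail_nonneg G (Real.exp y)
              gcongr
          _ = C₁ * C * ε' * tail F (Real.exp t) * (w (t - y) / w t * w y) *
              (Real.exp (α * y) * Real.exp (-α * y)) := by ring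
          _ = _ := by rw [e2, mul_one]
    _ ≤ ∫⁻ y in Ioc 0 t, ENNReal.ofReal
          (C₁ * C * ε' * tail F (Real.exp t) * (w (t - y) / w t * w y)) :=
        lintegral_mono_set (Ioc_subset_Ioc (le_max_right _ _) (by linarith))
    _ = ENNReal.ofReal (∫ y in Ioc 0 t,
          C₁ * C * ε' * tail F (Real.exp t) * (w (t - y) / w t * w y)) := by
        rw [ofReal_integral_eq_lintegral_ofReal]
        · exact (hint.1).const_mul _
        · filter_upwards [ae_restrict_mem measurableSet_Ioc] with y hy
          have hwy := hw.nonneg y hy.1.le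
          have hwty := hw.nonneg (t - y) (by linarith [hy.2])
          simp only [Pi.zero_apply]
          positivity
    _ ≤ _ := by
        refine ENNReal.ofReal_le_ofReal ?_
        rw [integral_const_mul, ← intervalIntegral.integral_of_le ht0]
        calc _ ≤ C₁ * C * ε' * tail F (Real.exp t) * M := by gcongr
          _ ≤ (C₁ * C + 1) * ε' * tail F (Real.exp t) * M := by gcongr; linarith
          _ = _ := by rw [hε']; field_simp

/-- Here w is L ∘ exp itself: the comparison is an identity, and smallness of the tail of `G`
relative to w is exactly the assumption relative to the tail of `F`. -/
lemma hasNegligibleLargeFactor_of_DZ2 {F G : Measure ℝ} [IsProbabilityMeasure F]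
    [IsProbabilityMeasure G] {α : ℝ} (hF : IsRegularlyVarying F α)
    (hGF : tail G =o[atTop] tail F) (h : DZ2 F α) : HasNegligibleLargeFactor F G := by
  refine hasNegligibleLargeFactor_of_subexponential hF hGF h.2 (C := 1) (b := 0) zero_le_one
    (fun r t _ _ => by rw [one_mul, mul_comm]) fun ε hε => ?_
  filter_upwards [Real.tendsto_exp_atTop.eventually (hGF.def hε)] with y hy
  rw [Real.norm_of_nonneg (tail_nonneg _ _), Real.norm_of_nonneg (tail_nonneg _ _)] at hy
  rw [slowPart_exp, ← mul_assoc (Real.exp _), ← Real.exp_add]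
  simpa using hy

/-- For a function of type (iii) or (iv), growth on the logarithmic scale is dominated by that of
the numerator tail. -/
lemma IsTypeIIIOrIV.exists_mul_tail_le {L : ℝ → ℝ} {U : Measure ℝ} (h : IsTypeIIIOrIV L U) :
    ∃ C b : ℝ, 0 ≤ C ∧ ∀ r t, b ≤ r → r ≤ t →
      L (Real.exp r) * tail U t ≤ C * L (Real.exp t) * tail U r := by
  -- Far out c lies between c₀/2 and 2c₀, so any two of its values differ by at most a factor 4.
  have hc : ∀ (c : ℝ → ℝ) (c₀ : ℝ), 0 < c₀ → Tendsto c atTop (𝓝 c₀) →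
      ∃ b, ∀ r, b ≤ r → 0 < c (Real.exp r) ∧ ∀ t, b ≤ t →
        c (Real.exp r) ≤ 4 * c (Real.exp t) := by
    intro c c₀ hc₀ hc
    have hce := hc.comp Real.tendsto_exp_atTop
    obtain ⟨b, hb⟩ := eventually_atTop.1
      ((hce.eventually_lt_const (show c₀ < 2 * c₀ by linarith)).and
        (hce.eventually_const_lt (show c₀ / 2 < c₀ by linarith)))
    refine ⟨b, fun r hr => ⟨?_, fun t ht => ?_⟩⟩
    · have := (hb r hr).2
      simp only [Function.comp] at this
      linarith
    · have h1 := (hb r hr).1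
      have h2 := (hb t ht).2
      simp only [Function.comp] at h1 h2
      linarith
  rcases h with ⟨_, _, c, c₀, hc₀, hlim, hL⟩ | ⟨V, _, _, _, hV, c, c₀, hc₀, hlim, hL⟩
  · obtain ⟨b, hb⟩ := hc c c₀ hc₀ hlim
    refine ⟨4, b, by norm_num, fun r t hr hrt => ?_⟩
    rw [hL _ (Real.exp_pos _), hL _ (Real.exp_pos _), Real.log_exp, Real.log_exp]
    have h1 := (hb r hr).2 t (hr.trans hrt)
    have h2 := tail_nonneg U r
    have h3 := tail_nonneg U t
    calc _ = c (Real.exp r) * (tail U r * tail U t) := by ring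
      _ ≤ 4 * c (Real.exp t) * (tail U r * tail U t) := by gcongr
      _ = _ := by ring
  -- In type (iv) the denominator only helps: the tail of `V` decreases from r to t.
  · obtain ⟨b, hb⟩ := hc c c₀ hc₀ hlim
    refine ⟨4, b, by norm_num, fun r t hr hrt => ?_⟩
    rw [hL _ (Real.exp_pos _), hL _ (Real.exp_pos _), Real.log_exp, Real.log_exp]
    have h1 := (hb r hr).2 t (hr.trans hrt)
    have h0 := (hb t (hr.trans hrt)).1
    have h2 := tail_nonneg U r
    have h3 := tail_nonneg U t
    have h4 := hV.tail_pos t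
    have h5 := tail_antitone V hrt
    calc _ = c (Real.exp r) * (tail U r * tail U t) / tail V r := by ring
      _ ≤ 4 * c (Real.exp t) * (tail U r * tail U t) / tail V t := by gcongr
      _ = _ := by ring

/-- Here w is the tail of `U`, and the type of L supplies the comparison. -/
lemma hasNegligibleLargeFactor_of_DZ3 {F G : Measure ℝ} [IsProbabilityMeasure F]
    [IsProbabilityMeasure G] {α : ℝ} (hF : IsRegularlyVarying F α)
    (hGF : tail G =o[atTop] tail F) (h : DZ3 F G α) : HasNegligibleLargeFactor F G := by
  obtain ⟨U, hU, hUs, hGU⟩ := h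
  obtain ⟨C, b, hC, hcomp⟩ := hU.exists_mul_tail_le
  refine hasNegligibleLargeFactor_of_subexponential hF hGF hUs hC hcomp fun ε hε => ?_
  filter_upwards [Real.tendsto_exp_atTop.eventually (hGU.def hε)] with y hy
  rw [Real.norm_of_nonneg (tail_nonneg _ _), ← Real.exp_mul, Real.log_exp, mul_comm y,
    Real.norm_of_nonneg (mul_nonneg (Real.exp_pos _).le (tail_nonneg _ _))] at hy
  exact hy

/-! ### Truncated moments and (DZ4) -/

lemma integrableOn_rpow_Icc (F : Measure ℝ) [IsFiniteMeasure F] {α : ℝ} (hα : 0 ≤ α) (z : ℝ) :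
    IntegrableOn (fun v => v ^ α) (Icc 0 z) F := by
  refine Measure.integrableOn_of_bounded (M := z ^ α) (measure_ne_top _ _)
    (by fun_prop) ?_
  filter_upwards [ae_restrict_mem measurableSet_Icc] with v hv
  rw [Real.norm_of_nonneg (Real.rpow_nonneg hv.1 _)]
  exact Real.rpow_le_rpow hv.1 hv.2 hα

lemma truncatedMoment_mono (F : Measure ℝ) [IsFiniteMeasure F] {α : ℝ} (hα : 0 ≤ α) :
    Monotone (truncatedMoment F α) := by
  intro x y hxy
  refine setIntegral_mono_set (integrableOn_rpow_Icc F hα y) ?_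
    (Icc_subset_Icc_right hxy).eventuallyLE
  filter_upwards [ae_restrict_mem measurableSet_Icc] with v hv
  exact Real.rpow_nonneg hv.1 _

/-- The slowly varying part is dominated by the truncated moment. -/
lemma IsRegularlyVarying.exists_slowPart_le {F : Measure ℝ} [IsFiniteMeasure F] {α : ℝ}
    (hF : IsRegularlyVarying F α) :
    ∃ D : ℝ, 0 ≤ D ∧ ∀ᶠ z in atTop, slowPart F α z ≤ D * truncatedMoment F α z := by
  have h2 : (1 : ℝ) < 2 ^ α := Real.one_lt_rpow one_lt_two hF.1
  -- The midpoint of 1 and 2 ^ α: eventually the tail at z/2 exceeds q times the tail at z, so (z/2,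
  -- z] carries at least (q - 1) times the tail at z, and there v ^ α ≥ (z/2) ^ α.
  set q : ℝ := (2 ^ α + 1) / 2 with hq
  have hq1 : 0 < q - 1 := by linarith
  refine ⟨2 ^ α / (q - 1), by positivity, ?_⟩
  filter_upwards [(hF.tendsto_div two_pos).eventually_const_lt (show q < 2 ^ α by linarith),
    eventually_gt_atTop 0] with z hz hz0
  rw [lt_div_iff₀ (hF.tail_pos z)] at hz
  have hsub : Ioc (z / 2) z ⊆ Icc 0 z := fun v hv => ⟨by linarith [hv.1], hv.2⟩
  have h3 : tail F (z / 2) - tail F z = F.real (Ioc (z / 2) z) := by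
    have := measureReal_union (μ := F) (Ioc_disjoint_Ioi_same (a := z / 2) (b := z)) measurableSet_Ioi
    rw [Ioc_union_Ioi_eq_Ioi (by linarith)] at this
    rw [tail, tail, this]; ring
  have h4 : (z / 2) ^ α * F.real (Ioc (z / 2) z) ≤ truncatedMoment F α z := by
    calc _ = ∫ v in Ioc (z / 2) z, (z / 2) ^ α ∂F := by simp [mul_comm]
      _ ≤ ∫ v in Ioc (z / 2) z, v ^ α ∂F := by
        refine setIntegral_mono_on (integrable_const _)
          ((integrableOn_rpow_Icc F hF.1.le z).mono_set hsub) measurableSet_Ioc fun v hv => ?_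
        exact Real.rpow_le_rpow (by positivity) hv.1.le hF.1.le
      _ ≤ _ := by
        refine setIntegral_mono_set (integrableOn_rpow_Icc F hF.1.le z) ?_ hsub.eventuallyLE
        filter_upwards [ae_restrict_mem measurableSet_Icc] with v hv
        exact Real.rpow_nonneg hv.1 _
  rw [div_mul_eq_mul_div, le_div_iff₀ hq1]
  rw [← h3, Real.div_rpow hz0.le zero_le_two, div_mul_eq_mul_div, div_le_iff₀ (by positivity)] at h4
  rw [slowPart]
  have h5 : (q - 1) * tail F z ≤ tail F (z / 2) - tail F z := by linarith
  calc _ = z ^ α * ((q - 1) * tail F z) := by ring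
    _ ≤ z ^ α * (tail F (z / 2) - tail F z) := by gcongr
    _ ≤ _ := by linarith

/-- By Tonelli one may condition on the first factor instead, so that bounds on the tail of `G`
become applicable. -/
lemma lintegral_Ioi_measure_Ioi_div (F G : Measure ℝ) [SFinite F] [SFinite G] (s x : ℝ) :
    ∫⁻ v in Ioi s, F (Ioi (x / v)) ∂G = ∫⁻ u, G {v | s < v ∧ x / v < u} ∂F := by
  have hm : MeasurableSet {p : ℝ × ℝ | s < p.1 ∧ x / p.1 < p.2} :=
    (measurableSet_lt measurable_const measurable_fst).inter
      (measurableSet_lt (measurable_const.div measurable_fst) measurable_snd)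
  have h1 := Measure.prod_apply (μ := G) (ν := F) hm
  have h2 := Measure.prod_apply_symm (μ := G) (ν := F) hm
  rw [h1] at h2
  rw [← lintegral_indicator measurableSet_Ioi]
  refine Eq.trans (lintegral_congr fun v => ?_) h2
  by_cases hv : v ∈ Ioi s
  · rw [indicator_of_mem hv]
    congr 1
    ext u
    simpa using fun _ => hv
  · rw [indicator_of_notMem hv]
    have : Prod.mk v ⁻¹' {p : ℝ × ℝ | s < p.1 ∧ x / p.1 < p.2} = ∅ := by
      ext u
      simp only [mem_preimage, mem_ofPred_eq, mem_empty_iff_false, iff_false]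
      exact fun h => hv h.1
    rw [this, measure_empty]

/-- The range where the second factor exceeds `√x`, split according to the first factor. -/
lemma lintegral_Ioi_sqrt_le (F G : Measure ℝ) [IsProbabilityMeasure F] [IsProbabilityMeasure G]
    {x : ℝ} (hx : 1 ≤ x) :
    ∫⁻ v in Ioi (√x), F (Ioi (x / v)) ∂G ≤
      G (Ioi x) + ∫⁻ u in Ioc 1 (√x), G (Ioi (x / u)) ∂F + G (Ioi (√x)) * F (Ioi (√x)) := by
  have hx0 : 0 < x := by linarith
  rw [lintegral_Ioi_measure_Ioi_div]
  -- If u ≤ 1, then uv > x forces v > x; if 1 < u ≤ √x, then v > x / u; if u > √x, only v > √x is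
  -- kept.
  have key : ∀ u, G {v | √x < v ∧ x / v < u} ≤
      G (Ioi x) + (Ioc 1 (√x)).indicator (fun u => G (Ioi (x / u))) u +
        (Ioi (√x)).indicator (fun _ => G (Ioi (√x))) u := by
    intro u
    have hpos : ∀ v, √x < v → 0 < v := fun v hv => (Real.sqrt_nonneg x).trans_lt hv
    rcases le_or_gt u 1 with hu | hu
    · refine le_trans (measure_mono fun v hv => ?_) (le_add_right (le_add_right le_rfl))
      have h1 := (div_lt_iff₀ (hpos v hv.1)).1 hv.2
      have := hpos v hv.1
      show x < v
      nlinarith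
    rcases le_or_gt u (√x) with hu2 | hu2
    · rw [indicator_of_mem (show u ∈ Ioc 1 (√x) from ⟨hu, hu2⟩)]
      refine le_trans (measure_mono fun v hv => ?_) (le_add_right (le_add_left le_rfl))
      have h1 := (div_lt_iff₀ (hpos v hv.1)).1 hv.2
      show x / u < v
      rw [div_lt_iff₀ (by linarith)]; linarith
    · rw [indicator_of_mem (show u ∈ Ioi (√x) from hu2)]
      refine le_trans (measure_mono fun v hv => ?_) (le_add_left le_rfl)
      exact hv.1
  refine (lintegral_mono key).trans ?_
  rw [lintegral_add_right _ (measurable_const.indicator measurableSet_Ioi),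
    lintegral_add_right _ ((measurable_tail_div G x).indicator measurableSet_Ioc),
    lintegral_indicator measurableSet_Ioi, lintegral_indicator measurableSet_Ioc]
  simp

lemma tendsto_measure_Ioi_atTop_zero (μ : Measure ℝ) [IsFiniteMeasure μ] :
    Tendsto (fun x => μ (Ioi x)) atTop (𝓝 0) := by
  have h := tendsto_measure_iInter_atTop (μ := μ) (s := fun x : ℝ => Ioi x)
    (fun _ => measurableSet_Ioi.nullMeasurableSet) (fun _ _ h => Ioi_subset_Ioi h)
    ⟨0, measure_ne_top _ _⟩
  have h0 : ⋂ x : ℝ, Ioi x = ∅ := by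
    ext y
    simpa using ⟨y, le_rfl⟩
  rwa [h0, measure_empty] at h

/-- For A < v ≤ √x, slow variation of L on [√x, x] reduces the claim to the tail of E[Y ^ α]. For v
> √x the roles of the factors are exchanged, and the m in the bound on the tail of `G` compensates
the moment of u up to √x. -/
lemma hasNegligibleLargeFactor_of_DZ4 {F G : Measure ℝ} [IsProbabilityMeasure F]
    [IsProbabilityMeasure G] {α : ℝ} (hF : IsRegularlyVarying F α)
    (hGF : tail G =o[atTop] tail F) (hGα : Integrable (fun v => v ^ α) G) (h : DZ4 F G α) :
    HasNegligibleLargeFactor F G := by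
  obtain ⟨-, hGm, C₀, hC₀⟩ := h
  obtain ⟨D, hD, hLm⟩ := hF.exists_slowPart_le
  obtain ⟨C, hC, hL⟩ : ∃ C : ℝ, 0 ≤ C ∧ ∀ᶠ x in atTop, ∀ y ∈ Icc (√x) x,
      slowPart F α y ≤ C * slowPart F α x := by
    refine ⟨max C₀ 0, le_max_right _ _, ?_⟩
    filter_upwards [hC₀, eventually_gt_atTop 0] with x hx hx0 y hy
    exact (div_le_iff₀ (slowPart_pos hF hx0)).1 ((hx y hy).trans (le_max_left _ _))
  intro ε hε
  -- The weights 1, C and C D belong to the three pieces with v > √x, which together receive ε / 2.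
  set ε' := ε / 2 / (1 + C + C * D) with hε'
  have hε'0 : 0 < ε' := by positivity
  have htailα : Tendsto (fun A => ∫⁻ v in Ioi A, ENNReal.ofReal (v ^ α) ∂G) atTop (𝓝 0) :=
    tendsto_setLIntegral_zero hGα.lintegral_lt_top.ne (tendsto_measure_Ioi_atTop_zero G)
  filter_upwards [eventually_ge_atTop 1, htailα.eventually_lt_const
    (show (0 : ENNReal) < ENNReal.ofReal (ε / 2 / (C + 1)) by
      rw [ENNReal.ofReal_pos]; positivity)] with A hA1 hA
  have hsq : Tendsto (fun x : ℝ => √x) atTop atTop := Real.tendsto_sqrt_atTop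
  obtain ⟨z₀, hz₀⟩ := eventually_atTop.1 (hGm.def hε'0)
  filter_upwards [hL, hsq.eventually hLm, hsq.eventually_ge_atTop z₀, hGF.def hε'0,
    eventually_ge_atTop 1] with x hLx hLmx hz₀x hGx hx1
  have hx0 : 0 < x := by linarith
  have hs0 : 0 < √x := Real.sqrt_pos.2 hx0
  have hs1 : 1 ≤ √x := Real.one_le_sqrt.2 hx1
  have hss : √x * √x = x := Real.mul_self_sqrt hx0.le
  have hsx : √x ≤ x := by nlinarith
  have hFx := hF.tail_pos x
  have hLs := slowPart_pos hF hs0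
  have hm0 : 0 < truncatedMoment F α (√x) := by
    by_contra hneg
    push Not at hneg
    nlinarith [mul_nonneg hD (neg_nonneg.2 hneg)]
  -- Since m is increasing, m(z) may be replaced by the single value m(√x) for all z ≥ √x.
  have hGle : ∀ z, √x ≤ z → tail G z ≤ ε' * (tail F z / truncatedMoment F α (√x)) := by
    intro z hz
    have h1 := hz₀ z (hz₀x.trans hz)
    have h2 := truncatedMoment_mono F hF.1.le hz
    have h3 := tail_nonneg F z
    rw [Real.norm_of_nonneg (tail_nonneg _ _), Real.norm_of_nonneg
      (div_nonneg h3 (hm0.le.trans h2))] at h1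
    exact h1.trans (by gcongr)
  -- For 1 ≤ v ≤ √x the point x / v lies in [√x, x], where L is at most C L(x).
  have hFdiv : ∀ v, 1 ≤ v → v ≤ √x → tail F (x / v) ≤ C * tail F x * v ^ α := by
    intro v hv1 hv2
    have hv0 : 0 < v := by linarith
    have h1 : x / v ∈ Icc (√x) x :=
      ⟨by rw [le_div_iff₀ hv0]; nlinarith, div_le_self hx0.le hv1⟩
    have h2 := hLx _ h1
    rw [tail_eq_rpow_mul_slowPart F α (div_pos hx0 hv0), tail_eq_rpow_mul_slowPart F α hx0,
      Real.div_rpow hx0.le hv0.le, Real.rpow_neg hv0.le, div_inv_eq_mul]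
    calc _ ≤ x ^ (-α) * v ^ α * (C * slowPart F α x) := by gcongr
      _ = _ := by ring
  have hpart1 : ∫⁻ v in Ioc A (√x), F (Ioi (x / v)) ∂G ≤ ENNReal.ofReal (ε / 2 * tail F x) := by
    calc _ ≤ ∫⁻ v in Ioc A (√x), ENNReal.ofReal (C * tail F x) * ENNReal.ofReal (v ^ α) ∂G := by
          refine setLIntegral_mono' measurableSet_Ioc fun v hv => ?_
          rw [← ofReal_tail, ← ENNReal.ofReal_mul (by positivity)]
          exact ENNReal.ofReal_le_ofReal (hFdiv v (hA1.trans hv.1.le) hv.2)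
      _ ≤ ENNReal.ofReal (C * tail F x) * ∫⁻ v in Ioi A, ENNReal.ofReal (v ^ α) ∂G := by
          rw [lintegral_const_mul _ (by fun_prop)]
          gcongr
          exact Ioc_subset_Ioi_self
      _ ≤ ENNReal.ofReal (C * tail F x) * ENNReal.ofReal (ε / 2 / (C + 1)) := by gcongr
      _ ≤ _ := by
          rw [← ENNReal.ofReal_mul (by positivity)]
          refine ENNReal.ofReal_le_ofReal ?_
          rw [mul_div_assoc', div_le_iff₀ (by positivity)]
          nlinarith [mul_pos hε hFx]
  have hpart2 : ∫⁻ u in Ioc 1 (√x), G (Ioi (x / u)) ∂F ≤ ENNReal.ofReal (ε' * C * tail F x) := by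
    calc _ ≤ ∫⁻ u in Ioc 1 (√x), ENNReal.ofReal
            (ε' * (C * tail F x) / truncatedMoment F α (√x) * u ^ α) ∂F := by
          refine setLIntegral_mono' measurableSet_Ioc fun u hu => ?_
          rw [← ofReal_tail]
          refine ENNReal.ofReal_le_ofReal ((hGle _ ?_).trans ?_)
          · have hu0 : 0 < u := by linarith [hu.1]
            rw [le_div_iff₀ hu0]; nlinarith [hu.2]
          · have := hFdiv u hu.1.le hu.2
            calc _ ≤ ε' * (C * tail F x * u ^ α / truncatedMoment F α (√x)) := by gcongr
              _ = _ := by ring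
      _ ≤ ∫⁻ u in Icc 0 (√x), ENNReal.ofReal
            (ε' * (C * tail F x) / truncatedMoment F α (√x) * u ^ α) ∂F :=
          lintegral_mono_set fun u hu => ⟨by linarith [hu.1], hu.2⟩
      _ = ENNReal.ofReal (∫ u in Icc 0 (√x),
            ε' * (C * tail F x) / truncatedMoment F α (√x) * u ^ α ∂F) := by
          rw [ofReal_integral_eq_lintegral_ofReal]
          · exact (integrableOn_rpow_Icc F hF.1.le _).const_mul _
          · filter_upwards [ae_restrict_mem measurableSet_Icc] with u hu
            have := Real.rpow_nonneg hu.1 α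
            simp only [Pi.zero_apply]
            positivity
      -- The integral of u ^ α up to √x is m(√x), cancelling the denominator.
      _ = _ := by
          rw [integral_const_mul]
          change ENNReal.ofReal (_ * truncatedMoment F α (√x)) = _
          congr 1
          field_simp
  have hpart3 : G (Ioi (√x)) * F (Ioi (√x)) ≤ ENNReal.ofReal (ε' * (C * D) * tail F x) := by
    rw [← ofReal_tail, ← ofReal_tail, ← ENNReal.ofReal_mul (tail_nonneg _ _)]
    refine ENNReal.ofReal_le_ofReal ?_
    have h0 := hF.tail_pos (√x)
    have h1 := hGle _ le_rfl
    have h2 := hLx _ ⟨le_rfl, hsx⟩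
    -- One factor L(√x) is compared with L(x), the other with m(√x); the powers combine to x ^ (-α).
    have h3 : tail F (√x) * tail F (√x) ≤ C * tail F x * (D * truncatedMoment F α (√x)) := by
      rw [tail_eq_rpow_mul_slowPart F α hx0]
      calc tail F (√x) * tail F (√x)
          = (√x * √x) ^ (-α) * (slowPart F α (√x) * slowPart F α (√x)) := by
            rw [tail_eq_rpow_mul_slowPart F α hs0, Real.mul_rpow hs0.le hs0.le]; ring
        _ ≤ x ^ (-α) * ((C * slowPart F α x) * (D * truncatedMoment F α (√x))) := by
            rw [hss]
            have := slowPart_pos hF hx0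
            gcongr
        _ = _ := by ring
    calc _ ≤ ε' * (tail F (√x) / truncatedMoment F α (√x)) * tail F (√x) := by gcongr
      _ = ε' * (tail F (√x) * tail F (√x)) / truncatedMoment F α (√x) := by ring
      _ ≤ ε' * (C * tail F x * (D * truncatedMoment F α (√x))) / truncatedMoment F α (√x) := by
          gcongr
      _ = _ := by field_simp
  have hpart0 : G (Ioi x) ≤ ENNReal.ofReal (ε' * tail F x) := by
    rw [← ofReal_tail]
    rw [Real.norm_of_nonneg (tail_nonneg _ _), Real.norm_of_nonneg (tail_nonneg _ _)] at hGx
    exact ENNReal.ofReal_le_ofReal hGx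
  have hsub : Ioi A ⊆ Ioc A (√x) ∪ Ioi (√x) := fun v hv => by
    rcases le_or_gt v (√x) with h | h
    · exact Or.inl ⟨hv, h⟩
    · exact Or.inr h
  calc _ ≤ ∫⁻ v in Ioc A (√x) ∪ Ioi (√x), F (Ioi (x / v)) ∂G := lintegral_mono_set hsub
    _ ≤ _ := lintegral_union_le _ _ _
    _ ≤ ENNReal.ofReal (ε / 2 * tail F x) + (ENNReal.ofReal (ε' * tail F x) +
          ENNReal.ofReal (ε' * C * tail F x) + ENNReal.ofReal (ε' * (C * D) * tail F x)) :=
        add_le_add hpart1 ((lintegral_Ioi_sqrt_le F G hx1).trans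
          (add_le_add (add_le_add hpart0 hpart2) hpart3))
    _ = _ := by
        rw [← ENNReal.ofReal_add (by positivity) (by positivity),
          ← ENNReal.ofReal_add (by positivity) (by positivity),
          ← ENNReal.ofReal_add (by positivity) (by positivity)]
        congr 1
        rw [hε']; field_simp; ring

/-! ### Boundedness of the Sarmanov density -/

/-- A mean-zero function that does not vanish almost everywhere is positive somewhere on any conull
set. -/
lemma exists_mem_pos_of_integral_eq_zero {μ : Measure ℝ} {f : ℝ → ℝ} (hf : Integrable f μ)
    (h0 : ∫ x, f x ∂μ = 0) (hne : ¬ f =ᵐ[μ] 0) {S : Set ℝ} (hS : ∀ᵐ x ∂μ, x ∈ S) :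
    ∃ x ∈ S, 0 < f x := by
  by_contra! hneg
  refine hne ?_
  have h1 : 0 ≤ᵐ[μ] fun x => -f x := by
    filter_upwards [hS] with x hx
    simpa using hneg x hx
  have h2 := (integral_eq_zero_iff_of_nonneg_ae h1 hf.neg).1 (by rw [integral_neg, h0, neg_zero])
  filter_upwards [h2] with x hx
  simpa using hx

/-- Nonnegativity of `1 + p x * q y` with `p` taking both signs forces `q` to be bounded. -/
lemma exists_abs_le_of_one_add_mul_nonneg {μ : Measure ℝ} {p q : ℝ → ℝ} (hp : Integrable p μ)
    (h0 : ∫ x, p x ∂μ = 0) (hne : ¬ p =ᵐ[μ] 0) {S T : Set ℝ} (hS : ∀ᵐ x ∂μ, x ∈ S)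
    (h : ∀ x ∈ S, ∀ y ∈ T, 0 ≤ 1 + p x * q y) :
    ∃ M, 0 ≤ M ∧ ∀ y ∈ T, |q y| ≤ M := by
  obtain ⟨a, ha, hpa⟩ := exists_mem_pos_of_integral_eq_zero hp h0 hne hS
  obtain ⟨b, hb, hpb⟩ := exists_mem_pos_of_integral_eq_zero (f := fun x => -p x) hp.neg
    (by rw [integral_neg, h0, neg_zero])
    (fun hz => hne (by filter_upwards [hz] with x hx; simpa using hx)) hS
  have hb' := inv_pos.2 hpb
  have ha' := inv_pos.2 hpa
  refine ⟨(p a)⁻¹ + (-p b)⁻¹, by positivity, fun y hy => abs_le.2 ⟨?_, ?_⟩⟩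
  · have h1 : -(p a)⁻¹ ≤ q y := by
      rw [neg_le, ← one_div, le_div_iff₀ hpa]
      linarith [h a ha y hy]
    linarith
  · have h1 : q y ≤ (-p b)⁻¹ := by
      rw [← one_div, le_div_iff₀ hpb]
      linarith [h b hb y hy]
    linarith

/-- The perturbation of the density of a Sarmanov distribution is bounded almost everywhere. -/
lemma IsBivariateSarmanov.exists_abs_le {Ω : Type*} [MeasurableSpace Ω] {P : Measure Ω}
    {X Y : Ω → ℝ} {φ₁ φ₂ : ℝ → ℝ} {θ : ℝ} (h : IsBivariateSarmanov P X Y φ₁ φ₂ θ) :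
    ∃ K, 0 ≤ K ∧ ∀ᵐ v ∂(P.map Y), ∀ᵐ u ∂(P.map X), |θ * φ₁ u * φ₂ v| ≤ K := by
  have hS : ∀ᵐ x ∂(P.map X), x ∈ (P.map X).support := Measure.measure_compl_support
  have hT : ∀ᵐ y ∂(P.map Y), y ∈ (P.map Y).support := Measure.measure_compl_support
  by_cases h1 : (fun u => θ * φ₁ u) =ᵐ[P.map X] 0
  · refine ⟨0, le_rfl, Eventually.of_forall fun v => ?_⟩
    filter_upwards [h1] with u hu
    simp only [Pi.zero_apply] at hu
    simp [hu]
  by_cases h2 : φ₂ =ᵐ[P.map Y] 0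
  · refine ⟨0, le_rfl, ?_⟩
    filter_upwards [h2] with v hv
    simp [hv]
  -- With neither factor null, the sign changes of each one bound the other on its support; θ is
  -- absorbed into φ₁.
  obtain ⟨M₂, hM₂, hb₂⟩ := exists_abs_le_of_one_add_mul_nonneg (q := φ₂)
    (h.integrable_left.const_mul θ) (by rw [integral_const_mul, h.integral_left, mul_zero]) h1 hS
    h.density_nonneg
  obtain ⟨M₁, hM₁, hb₁⟩ := exists_abs_le_of_one_add_mul_nonneg (q := fun u => θ * φ₁ u)
    h.integrable_right h.integral_right h2 hT
    (fun y hy x hx => by rw [mul_comm (φ₂ y)]; exact h.density_nonneg x hx y hy)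
  refine ⟨M₁ * M₂, by positivity, ?_⟩
  filter_upwards [hT] with v hv
  filter_upwards [hS] with u hu
  rw [abs_mul]
  exact mul_le_mul (hb₁ u hu) (hb₂ v hv) (abs_nonneg _) hM₁

/-! ### Breiman-type limit for a bounded joint density -/

/-- Averages over far right tails converge to the limit at infinity. -/
lemma tendsto_setIntegral_Ioi_div_tail {F : Measure ℝ} [IsFiniteMeasure F] {g : ℝ → ℝ} {l : ℝ}
    (hF : ∀ x, 0 < tail F x) (hg : Integrable g F) (hl : Tendsto g atTop (𝓝 l)) :
    Tendsto (fun z => (∫ u in Ioi z, g u ∂F) / tail F z) atTop (𝓝 l) := by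
  rw [Metric.tendsto_atTop]
  intro ε hε
  obtain ⟨z₀, hz₀⟩ := Metric.tendsto_atTop.1 hl (ε / 2) (half_pos hε)
  refine ⟨z₀, fun z hz => ?_⟩
  have h1 : ‖∫ u in Ioi z, (g u - l) ∂F‖ ≤ ε / 2 * F.real (Ioi z) :=
    norm_setIntegral_le_of_norm_le_const (measure_lt_top _ _)
      fun u hu => (hz₀ u (hz.le.trans (le_of_lt hu))).le
  rw [integral_sub hg.integrableOn (integrable_const l), setIntegral_const, smul_eq_mul] at h1
  change ‖_ - tail F z * l‖ ≤ ε / 2 * tail F z at h1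
  have hz' := hF z
  rw [Real.dist_eq, div_sub' hz'.ne', abs_div, abs_of_pos hz', div_lt_iff₀ hz']
  refine h1.trans_lt ?_
  nlinarith

/-- The limit at infinity of a function that is bounded almost everywhere with respect to a law with
unbounded support obeys the same bound. -/
lemma abs_le_of_tendsto_of_ae_abs_le {F : Measure ℝ} [IsFiniteMeasure F] {g : ℝ → ℝ} {l K : ℝ}
    (hF : ∀ x, 0 < tail F x) (hl : Tendsto g atTop (𝓝 l)) (hK : ∀ᵐ u ∂F, |g u| ≤ K) : |l| ≤ K := by
  refine le_of_tendsto_of_frequently hl.abs (frequently_atTop.2 fun a => ?_)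
  by_contra! hneg
  have h0 : F (Ioi a) = 0 := measure_mono_null (fun u hu => not_le.2 (hneg u (le_of_lt hu))) hK
  have := hF a
  simp [tail, measureReal_def, h0] at this

/-- Breiman-type asymptotics for a joint law with a bounded density `k` with respect to the product
of the marginals. -/
theorem tendsto_setIntegral_mul_div_tail {F G : Measure ℝ} [IsProbabilityMeasure F]
    [IsProbabilityMeasure G] {α K : ℝ} (hF : IsRegularlyVarying F α) (hG0 : ∀ᵐ v ∂G, 0 ≤ v)
    (hFG : HasNegligibleLargeFactor F G)
    {k : ℝ → ℝ → ℝ} {κ : ℝ → ℝ} (hk : Integrable (fun p : ℝ × ℝ => k p.1 p.2) (F.prod G))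
    (hK0 : 0 ≤ K) (hK : ∀ᵐ v ∂G, ∀ᵐ u ∂F, |k u v| ≤ K)
    (hκ : ∀ᵐ v ∂G, Tendsto (fun u => k u v) atTop (𝓝 (κ v)))
    (hint : Integrable (fun v => κ v * v ^ α) G) :
    Tendsto (fun x => (∫ p in {p : ℝ × ℝ | x < p.1 * p.2}, k p.1 p.2 ∂(F.prod G)) / tail F x) atTop
      (𝓝 (∫ v, κ v * v ^ α ∂G)) := by
  have hS : ∀ x : ℝ, MeasurableSet {p : ℝ × ℝ | x < p.1 * p.2} := fun x =>
    measurableSet_lt measurable_const (measurable_fst.mul measurable_snd)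
  set g : ℝ → ℝ × ℝ → ℝ := fun x =>
    {p : ℝ × ℝ | x < p.1 * p.2}.indicator (fun p => k p.1 p.2) with hg
  have hgi : ∀ x, Integrable (g x) (F.prod G) := fun x => hk.indicator (hS x)
  set h : ℝ → ℝ → ℝ := fun x v => (∫ u, g x (u, v) ∂F) / tail F x with hh
  have hhi : ∀ x, Integrable (h x) G := fun x => ((hgi x).integral_prod_right).div_const _
  have heq : ∀ x, (∫ p in {p : ℝ × ℝ | x < p.1 * p.2}, k p.1 p.2 ∂(F.prod G)) / tail F x =
      ∫ v, h x v ∂G := fun x => by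
    rw [integral_div, ← integral_indicator (hS x), ← integral_prod_symm _ (hgi x)]
  simp_rw [heq]
  have hpos : ∀ x v, 0 < v → h x v = (∫ u in Ioi (x / v), k u v ∂F) / tail F x := by
    intro x v hv
    simp only [hh]
    rw [← integral_indicator measurableSet_Ioi]
    congr 2
    ext u
    simp only [hg, indicator, mem_ofPred_eq, mem_Ioi, div_lt_iff₀ hv]
  -- An atom of `G` at 0 is treated apart, since x / 0 is `0` and the slice formula fails there.
  have hzero : ∀ x, 0 < x → h x 0 = 0 := by
    intro x hx
    simp [hh, hg, indicator, hx.not_gt]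
  have hbound : ∀ x, 0 < x → ∀ᵐ v ∂G, ‖h x v‖ ≤ K * tail F (x / v) / tail F x := by
    intro x hx
    filter_upwards [hG0, hK] with v hv hKv
    have hFx := hF.tail_pos x
    rcases hv.eq_or_lt with rfl | hv
    · rw [hzero x hx, norm_zero]
      have := tail_nonneg F (x / 0)
      positivity
    · rw [hpos x v hv, norm_div, Real.norm_of_nonneg hFx.le]
      gcongr
      exact norm_setIntegral_le_of_norm_le_const_ae' (measure_lt_top _ _)
        (hKv.mono fun u hu _ => hu)
  have hsec : ∀ᵐ v ∂G, Integrable (fun u => k u v) F := hk.prod_left_ae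
  have hlim : ∀ᵐ v ∂G, Tendsto (fun x => h x v) atTop (𝓝 (κ v * v ^ α)) := by
    filter_upwards [hG0, hκ, hsec] with v hv hκv hiv
    rcases hv.eq_or_lt with rfl | hv
    · rw [Real.zero_rpow hF.1.ne', mul_zero]
      refine tendsto_const_nhds.congr' ?_
      filter_upwards [eventually_gt_atTop 0] with x hx
      rw [hzero x hx]
    · have h1 := (tendsto_setIntegral_Ioi_div_tail hF.tail_pos hiv hκv).comp
        (tendsto_id.atTop_div_const hv)
      -- The ratio splits into the average of k over u > x / v times the tail ratio at x / v and x.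
      refine (h1.mul (hF.tendsto_div hv)).congr fun x => ?_
      have := (hF.tail_pos (x / v)).ne'
      rw [hpos x v hv]
      simp only [Function.comp, id]
      field_simp
  have hnear : ∀ A, 0 < A → Tendsto (fun x => ∫ v in Iic A, h x v ∂G) atTop
      (𝓝 (∫ v in Iic A, κ v * v ^ α ∂G)) := by
    intro A hA
    refine tendsto_integral_filter_of_dominated_convergence (fun _ => K * (A ^ α + 1))
      (Eventually.of_forall fun x => (hhi x).aestronglyMeasurable.restrict) ?_
      (integrable_const _) (ae_restrict_of_ae hlim)
    filter_upwards [eventually_gt_atTop 0, hF.eventually_tail_div_le hA] with x hx hxA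
    filter_upwards [ae_restrict_of_ae (hbound x hx), ae_restrict_of_ae hG0,
      ae_restrict_mem measurableSet_Iic] with v hv hv0 hvA
    have hFx := hF.tail_pos x
    have hA1 : 0 ≤ A ^ α + 1 := by positivity
    rcases hv0.eq_or_lt with rfl | hv0
    · rw [hzero x hx, norm_zero]; positivity
    refine hv.trans ?_
    rw [div_le_iff₀ hFx, mul_assoc]
    gcongr
    refine (tail_antitone F ?_).trans hxA
    exact div_le_div_of_nonneg_left hx.le hv0 hvA
  have hfar : ∀ ε : ℝ, 0 < ε → ∀ᶠ A in atTop, ∀ᶠ x in atTop,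
      ‖∫ v in Ioi A, h x v ∂G‖ ≤ K * ε := by
    intro ε hε
    filter_upwards [hFG ε hε] with A hA
    filter_upwards [hA, eventually_gt_atTop 0] with x hx hx0
    have hFx := hF.tail_pos x
    refine (norm_integral_le_lintegral_norm _).trans (ENNReal.toReal_le_of_le_ofReal
      (by positivity) ?_)
    calc _ ≤ ∫⁻ v in Ioi A, ENNReal.ofReal (K / tail F x) * F (Ioi (x / v)) ∂G := by
          refine lintegral_mono_ae (ae_restrict_of_ae ?_)
          filter_upwards [hbound x hx0] with v hv
          rw [← ofReal_tail, ← ENNReal.ofReal_mul (by positivity), div_mul_eq_mul_div]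
          exact ENNReal.ofReal_le_ofReal hv
      _ = ENNReal.ofReal (K / tail F x) * ∫⁻ v in Ioi A, F (Ioi (x / v)) ∂G :=
          lintegral_const_mul _ (measurable_tail_div F x)
      _ ≤ ENNReal.ofReal (K / tail F x) * ENNReal.ofReal (ε * tail F x) := by gcongr
      _ = _ := by
          rw [← ENNReal.ofReal_mul (by positivity)]
          congr 1
          field_simp
  have hlimfar : Tendsto (fun A => ∫ v in Ioi A, κ v * v ^ α ∂G) atTop (𝓝 0) :=
    hint.tendsto_setIntegral_nhds_zero (tendsto_measure_Ioi_atTop_zero G)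
  rw [Metric.tendsto_nhds]
  intro ε hε
  -- Three errors of at most ε / 4 arise: the part v > A before the limit, the same part of the
  -- limit, and the convergence on v ≤ A. Dividing by K + 1 allows K = 0.
  obtain ⟨A, hA1, hA2, hA0⟩ := ((hfar (ε / 4 / (K + 1)) (by positivity)).and
    ((Metric.tendsto_nhds.1 hlimfar (ε / 4) (by positivity)).and (eventually_gt_atTop 0))).exists
  filter_upwards [hA1, Metric.tendsto_nhds.1 (hnear A hA0) (ε / 4) (by positivity)] with x h1 h2
  have h3 : K * (ε / 4 / (K + 1)) ≤ ε / 4 := by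
    rw [mul_div_assoc', div_le_iff₀ (by positivity)]
    nlinarith
  rw [Real.dist_eq] at h2 hA2 ⊢
  rw [sub_zero] at hA2
  rw [← integral_add_compl measurableSet_Iic (hhi x), ← integral_add_compl measurableSet_Iic hint,
    compl_Iic]
  have h4 := h1.trans h3
  rw [Real.norm_eq_abs, abs_le] at h4
  rw [abs_lt] at h2 hA2 ⊢
  constructor <;> linarith

/-! ### The Sarmanov law and the conclusion -/

/-- Probabilities under a Sarmanov distribution as integrals against the product of the
marginals. -/
lemma IsBivariateSarmanov.measureReal_eq_setIntegral {Ω : Type*} [MeasurableSpace Ω]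
    {P : Measure Ω} [IsProbabilityMeasure P] {X Y : Ω → ℝ} {φ₁ φ₂ : ℝ → ℝ} {θ : ℝ}
    (h : IsBivariateSarmanov P X Y φ₁ φ₂ θ) {S : Set (ℝ × ℝ)} (hS : MeasurableSet S) :
    Integrable (fun p : ℝ × ℝ => 1 + θ * φ₁ p.1 * φ₂ p.2) ((P.map X).prod (P.map Y)) ∧
    P.real {ω | (X ω, Y ω) ∈ S} =
      ∫ p in S, (1 + θ * φ₁ p.1 * φ₂ p.2) ∂((P.map X).prod (P.map Y)) := by
  have := Measure.isProbabilityMeasure_map (μ := P) h.measurable_left.aemeasurable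
  have := Measure.isProbabilityMeasure_map (μ := P) h.measurable_right.aemeasurable
  have hi : Integrable (fun p : ℝ × ℝ => 1 + θ * φ₁ p.1 * φ₂ p.2)
      ((P.map X).prod (P.map Y)) :=
    (integrable_const 1).add ((h.integrable_left.const_mul θ).mul_prod h.integrable_right)
  refine ⟨hi, ?_⟩
  have h1 : ∀ᵐ p ∂((P.map X).prod (P.map Y)), p.1 ∈ (P.map X).support :=
    Measure.quasiMeasurePreserving_fst.ae
      (Measure.measure_compl_support : ∀ᵐ x ∂(P.map X), x ∈ (P.map X).support)
  have h2 : ∀ᵐ p ∂((P.map X).prod (P.map Y)), p.2 ∈ (P.map Y).support :=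
    Measure.quasiMeasurePreserving_snd.ae
      (Measure.measure_compl_support : ∀ᵐ x ∂(P.map Y), x ∈ (P.map Y).support)
  have h3 : 0 ≤ᵐ[((P.map X).prod (P.map Y)).restrict S] fun p => 1 + θ * φ₁ p.1 * φ₂ p.2 := by
    refine ae_restrict_of_ae ?_
    filter_upwards [h1, h2] with p hp1 hp2
    exact h.density_nonneg _ hp1 _ hp2
  have h4 : P {ω | (X ω, Y ω) ∈ S} = (P.map fun ω => (X ω, Y ω)) S :=
    (Measure.map_apply (h.measurable_left.prodMk h.measurable_right) hS).symm
  rw [measureReal_def, h4, h.joint_law, withDensity_apply _ hS,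
    integral_eq_lintegral_of_nonneg_ae h3 hi.aestronglyMeasurable.restrict]

end SarmanovProduct

theorem theorem4 {Ω : Type*} [MeasurableSpace Ω] (P : Measure Ω) [IsProbabilityMeasure P]
    (X Y : Ω → ℝ) (φ₁ φ₂ : ℝ → ℝ) (θ α d₁ : ℝ)
    (hXY : IsBivariateSarmanov P X Y φ₁ φ₂ θ)
    (hX_nonneg : ∀ᵐ ω ∂P, 0 ≤ X ω)
    (hX : IsRegularlyVarying (P.map X) α)
    (hY : Integrable (fun ω => Y ω ^ α) P)
    (hYX : tail (P.map Y) =o[atTop] tail (P.map X))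
    (hφ₁ : Tendsto φ₁ atTop (𝓝 d₁))
    (hDZ : DZ2 (P.map X) α ∨ DZ3 (P.map X) (P.map Y) α ∨ DZ4 (P.map X) (P.map Y) α) :
    (θ * d₁ ≠ 0 → Integrable (fun ω => φ₂ (Y ω) * Y ω ^ α) P) ∧
      Tendsto (fun x => P.real {ω | x < X ω * Y ω} / P.real {ω | x < X ω}) atTop
        (𝓝 ((∫ ω, Y ω ^ α ∂P) + θ * d₁ * ∫ ω, φ₂ (Y ω) * Y ω ^ α ∂P)) := by
  have hXm := hXY.measurable_left
  have hYm := hXY.measurable_right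
  have := Measure.isProbabilityMeasure_map (μ := P) hXm.aemeasurable
  have := Measure.isProbabilityMeasure_map (μ := P) hYm.aemeasurable
  have hpow : Measurable fun v : ℝ => v ^ α := by fun_prop
  have hGα : Integrable (fun v => v ^ α) (P.map Y) :=
    (integrable_map_measure hpow.aestronglyMeasurable hYm.aemeasurable).2 hY
  have hneg : HasNegligibleLargeFactor (P.map X) (P.map Y) := by
    rcases hDZ with h | h | h
    · exact hasNegligibleLargeFactor_of_DZ2 hX hYX h
    · exact hasNegligibleLargeFactor_of_DZ3 hX hYX h
    · exact hasNegligibleLargeFactor_of_DZ4 hX hYX hGα h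
  have hG0 : ∀ᵐ v ∂(P.map Y), 0 ≤ v := by
    filter_upwards [(Measure.measure_compl_support :
      ∀ᵐ y ∂(P.map Y), y ∈ (P.map Y).support)] with v hv
    exact hXY.support_right hv
  obtain ⟨K, hK0, hK⟩ := hXY.exists_abs_le
  have hlim : ∀ v, Tendsto (fun u => θ * φ₁ u * φ₂ v) atTop (𝓝 (θ * d₁ * φ₂ v)) :=
    fun v => (hφ₁.const_mul θ).mul_const _
  have hpm : AEStronglyMeasurable (fun v => θ * d₁ * φ₂ v) (P.map Y) :=
    hXY.integrable_right.aestronglyMeasurable.const_mul _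
  -- The factor θ d₁ φ₂(v) is a limit of θ φ₁(u) φ₂(v), hence inherits the bound K; its product with
  -- v ^ α is integrable without any assumption on φ₂(Y) Y ^ α.
  have hpert : Integrable (fun v => θ * d₁ * φ₂ v * v ^ α) (P.map Y) := by
    refine hGα.bdd_mul hpm (c := K) ?_
    filter_upwards [hK] with v hv
    exact abs_le_of_tendsto_of_ae_abs_le hX.tail_pos (hlim v) hv
  have hφm : AEStronglyMeasurable (fun v => φ₂ v * v ^ α) (P.map Y) :=
    hXY.integrable_right.aestronglyMeasurable.mul hpow.aestronglyMeasurable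
  refine ⟨fun hne => ?_, ?_⟩
  · have h1 : Integrable (fun v => φ₂ v * v ^ α) (P.map Y) := by
      refine (hpert.const_mul (θ * d₁)⁻¹).congr (Eventually.of_forall fun v => ?_)
      simp only
      rw [mul_assoc (θ * d₁), inv_mul_cancel_left₀ hne]
    exact (integrable_map_measure hφm hYm.aemeasurable).1 h1
  · have hmain := tendsto_setIntegral_mul_div_tail (K := 1 + K)
      (k := fun u v => 1 + θ * φ₁ u * φ₂ v) (κ := fun v => 1 + θ * d₁ * φ₂ v) hX hG0 hneg
      (hXY.measureReal_eq_setIntegral MeasurableSet.univ).1 (by positivity)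
      (by
        filter_upwards [hK] with v hv
        filter_upwards [hv] with u hu
        refine (abs_add_le _ _).trans ?_
        rw [abs_one]
        linarith)
      (Eventually.of_forall fun v => (hlim v).const_add 1)
      ((hGα.add hpert).congr (Eventually.of_forall fun v => by simp only [Pi.add_apply]; ring))
    have hval : ∫ v, (1 + θ * d₁ * φ₂ v) * v ^ α ∂(P.map Y) =
        (∫ ω, Y ω ^ α ∂P) + θ * d₁ * ∫ ω, φ₂ (Y ω) * Y ω ^ α ∂P := by
      -- Pulling out θ d₁ needs no integrability: if φ₂(Y) Y ^ α is not integrable then θ d₁ = 0,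
      -- and the value assigned to its integral is irrelevant.
      rw [← integral_map hYm.aemeasurable hpow.aestronglyMeasurable,
        ← integral_map hYm.aemeasurable hφm, ← integral_const_mul, ← integral_add hGα
          (by simpa only [mul_assoc] using hpert)]
      congr 1
      ext v
      ring
    rw [hval] at hmain
    refine hmain.congr fun x => ?_
    have hS : MeasurableSet {p : ℝ × ℝ | x < p.1 * p.2} :=
      measurableSet_lt measurable_const (measurable_fst.mul measurable_snd)
    rw [← (hXY.measureReal_eq_setIntegral hS).2]
    congr 1
    rw [tail, map_measureReal_apply hXm measurableSet_Ioi]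
    rfl
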